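/- All graphs are finite and simple. A graph $G$ contains a graph $H$ as an \emph{immersion} if the vertices of $H$ can be mapped to distinct vertices of $G$ and the edges of $H$ can be mapped to pairwise edge-disjoint paths in $G$, such that each edge $vw$ of $H$ is mapped to a path whose endpoints are the images of $v$ and $w$. A graph is \emph{$k$-colourable with defect $d$} if each of its vertices can be assigned one of $k$ colours such that each vertex is adjacent to at most $d$ vertices of its own colour. The \emph{defective chromatic number} $\chi_\Delta(\mathcal{G})$ of a graph class $\mathcal{G}$ is the minimum integer $k$ for which there is an integer $d$ such that every graph in $\mathcal{G}$ is $k$-colourable with defect $d$. \textbf{Theorem.} For $t \geq 1$, let $\mathcal{I}_t$ be the class of graphs that do not contain the complete graph $K_t$ as an immersion. Then every graph in $\mathcal{I}_t$ is $2$-colourable with defect $(t-1)^3$. Moreover, if $t \geq 3$, then $\chi_\Delta(\mathcal{I}_t) = 2$. -/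

import Mathlib

universe u

/-- `G` contains `H` as an immersion: the vertices of `H` are mapped injectively to vertices of `G`,
and the edges of `H` are mapped to pairwise edge-disjoint paths of `G` joining the images of their
ends. The path of an edge is given for both orientations of it, the two being reverse to each
other. -/
def ContainsImmersion {W : Type*} {V : Type*} (H : SimpleGraph W) (G : SimpleGraph V) : Prop :=
  ∃ (φ : W ↪ V) (P : ∀ a b : W, H.Adj a b → G.Walk (φ a) (φ b)),
    (∀ (a b : W) (h : H.Adj a b), (P a b h).IsPath) ∧
    (∀ (a b : W) (h : H.Adj a b), P b a h.symm = (P a b h).reverse) ∧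
    (∀ (a b : W) (h : H.Adj a b) (a' b' : W) (h' : H.Adj a' b'), s(a, b) ≠ s(a', b') →
      List.Disjoint (P a b h).edges (P a' b' h').edges)

/-- `G` is `k`-colourable with defect `d`: each vertex can be assigned one of `k` colours such that
every vertex is adjacent to at most `d` neighbours of its own colour. -/
def ColourableWithDefect {V : Type*} (G : SimpleGraph V) (k d : ℕ) : Prop :=
  ∃ c : V → Fin k, ∀ v : V, {w : V | G.Adj v w ∧ c w = c v}.encard ≤ d

/-- A class of finite simple graphs. -/
def GraphClass : Type (u + 1) :=
  ∀ (V : Type u) [Finite V], SimpleGraph V → Prop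

/-- A graph class is defectively `k`-colourable if for some `d` all its members are `k`-colourable
with defect `d`. -/
def DefectivelyColourable (𝒢 : GraphClass.{u}) (k : ℕ) : Prop :=
  ∃ d : ℕ, ∀ (V : Type u) [Finite V] (G : SimpleGraph V), 𝒢 V G → ColourableWithDefect G k d

/-- The least `k` such that the class is defectively `k`-colourable; it is `⊤` if there is none. -/
noncomputable def defectiveChromaticNumber (𝒢 : GraphClass.{u}) : ℕ∞ :=
  sInf {n : ℕ∞ | ∃ k : ℕ, n = k ∧ DefectivelyColourable 𝒢 k}

/-- The class of finite graphs that do not contain the complete graph on `t` vertices as an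
immersion. -/
def immersionFree (t : ℕ) : GraphClass.{u} :=
  fun _ _ G => ¬ ContainsImmersion (SimpleGraph.completeGraph (Fin t)) G

open Finset

/-! Call a cut small if it has fewer than `(t - 1) ^ 2` edges. If `t` vertices were pairwise
unseparated by small cuts, then `t - 1` tokens at each could be routed to one of them along
edge-disjoint walks; joining the walks of tokens `(a, b)` and `(b, a)` would give an immersion of
`K_t` (`containsImmersion_of_edgeConnected`).

So small cuts split the vertices into bags of at most `t - 1`. Uncrossing lets a laminar family of
small cuts achieve this (`IsLightestCut.laminar`, `exists_isLightestCut`). Each bag belongs to the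
smallest member containing it. Make the parent of a member `Y` the smallest member containing `Y`
and all neighbours of its bag, and colour members so that each differs from its parent. A neighbour
of `v` of the same colour is then in the bag of `v` or is charged to an edge leaving the member of
`v`, at most one bag per edge (`colourable_of_laminar`).

For `t ≥ 3`, stars contain no immersion of `K_t` but have unbounded defect with one colour. -/

/-- The arcs of `G`: each edge is counted in both directions. -/
noncomputable def arcs {V : Type*} [Fintype V] (G : SimpleGraph V) : Finset (V × V) := by
  classical exact {p | G.Adj p.1 p.2}

@[simp]
theorem mem_arcs {V : Type*} [Fintype V] {G : SimpleGraph V} {p : V × V} :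
    p ∈ arcs G ↔ G.Adj p.1 p.2 := by
  classical simp [arcs]

/-! ### Edge-disjoint routing under a cut condition -/

section Cuts

variable {V : Type*} [DecidableEq V]

/-- The number of arcs of `A` that leave the vertex set `S`. -/
def outDeg (A : Finset (V × V)) (S : Finset V) : ℕ :=
  ∑ p ∈ A, if p.1 ∈ S ∧ p.2 ∉ S then 1 else 0

theorem outDeg_eq_card (A : Finset (V × V)) (S : Finset V) :
    outDeg A S = #{p ∈ A | p.1 ∈ S ∧ p.2 ∉ S} := by
  simp [outDeg]

theorem outDeg_inter_add_union_le (A : Finset (V × V)) (S T : Finset V) :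
    outDeg A (S ∩ T) + outDeg A (S ∪ T) ≤ outDeg A S + outDeg A T := by
  simp only [outDeg, ← sum_add_distrib]
  refine sum_le_sum fun p _ => ?_
  by_cases h1 : p.1 ∈ S <;> by_cases h2 : p.1 ∈ T <;> by_cases h3 : p.2 ∈ S <;>
    by_cases h4 : p.2 ∈ T <;> simp [h1, h2, h3, h4]

/-- An arc from `S \ T` to `T \ S` leaves `S` but neither `S ∩ T` nor `S ∪ T`, so submodularity is
strict. -/
theorem outDeg_inter_add_union_lt {A : Finset (V × V)} {S T : Finset V} {x y : V}
    (hA : (x, y) ∈ A) (hxS : x ∈ S) (hxT : x ∉ T) (hyS : y ∉ S) (hyT : y ∈ T) :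
    outDeg A (S ∩ T) + outDeg A (S ∪ T) < outDeg A S + outDeg A T := by
  simp only [outDeg, ← sum_add_distrib]
  refine sum_lt_sum (fun p _ => ?_) ⟨(x, y), hA, by simp [hxS, hxT, hyS, hyT]⟩
  by_cases h1 : p.1 ∈ S <;> by_cases h2 : p.1 ∈ T <;> by_cases h3 : p.2 ∈ S <;>
    by_cases h4 : p.2 ∈ T <;> simp [h1, h2, h3, h4]

theorem outDeg_erase {A : Finset (V × V)} {p : V × V} (hp : p ∈ A) (S : Finset V) :
    outDeg A S = (if p.1 ∈ S ∧ p.2 ∉ S then 1 else 0) + outDeg (A.erase p) S :=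
  (add_sum_erase A _ hp).symm

/-- The number of indices `i` with `s i` in `S`. -/
def load {ι : Type*} [Fintype ι] (s : ι → V) (S : Finset V) : ℕ :=
  ∑ i, if s i ∈ S then 1 else 0

theorem load_inter_add_union {ι : Type*} [Fintype ι] (s : ι → V) (S T : Finset V) :
    load s (S ∩ T) + load s (S ∪ T) = load s S + load s T := by
  simp only [load, ← sum_add_distrib]
  refine sum_congr rfl fun i _ => ?_
  by_cases h1 : s i ∈ S <;> by_cases h2 : s i ∈ T <;> simp [h1, h2]

theorem load_update {ι : Type*} [Fintype ι] [DecidableEq ι] (s : ι → V) (i : ι) (u : V)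
    (S : Finset V) :
    load (Function.update s i u) S + (if s i ∈ S then 1 else 0)
      = load s S + (if u ∈ S then 1 else 0) := by
  have h1 := (add_sum_erase univ
    (fun j => if Function.update s i u j ∈ S then 1 else 0) (mem_univ i)).symm
  have h2 := (add_sum_erase univ (fun j => if s j ∈ S then 1 else 0) (mem_univ i)).symm
  have h3 : ∑ j ∈ univ.erase i, (if Function.update s i u j ∈ S then 1 else 0)
      = ∑ j ∈ univ.erase i, (if s j ∈ S then 1 else 0) :=
    sum_congr rfl fun j hj => by rw [Function.update_of_ne (ne_of_mem_erase hj)]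
  simp only [Function.update_self] at h1
  unfold load
  rw [h1, h2, h3]
  ring

variable [Fintype V]

/-- An inclusion-minimal arc set satisfying the cut condition has no pair of opposite arcs. -/
theorem exists_antisymm_subset {ι : Type*} [Fintype ι] (s : ι → V) (h : V) (A : Finset (V × V))
    (hA : ∀ S : Finset V, h ∉ S → load s S ≤ outDeg A S) :
    ∃ B ⊆ A, (∀ S : Finset V, h ∉ S → load s S ≤ outDeg B S) ∧
      ∀ x y, (x, y) ∈ B → (y, x) ∉ B := by
  obtain ⟨B, hBA, hB⟩ := exists_minimal_le_of_wellFoundedLT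
    (fun B : Finset (V × V) => ∀ S : Finset V, h ∉ S → load s S ≤ outDeg B S) A hA
  refine ⟨B, hBA, hB.prop, fun x y hxy hyx => ?_⟩
  -- By minimality, deleting `p` violates the cut condition at some set; that set is tight and `p`
  -- leaves it. Opposite arcs would give two tight sets that cross strictly.
  have key : ∀ p ∈ B, ∃ S : Finset V, h ∉ S ∧ p.1 ∈ S ∧ p.2 ∉ S ∧ outDeg B S ≤ load s S := by
    intro p hp
    have : ¬ ∀ S : Finset V, h ∉ S → load s S ≤ outDeg (B.erase p) S := fun hh =>
      notMem_erase p B (hB.le_of_le hh (erase_subset p B) hp)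
    push Not at this
    obtain ⟨S, hS, hlt⟩ := this
    have h1 := outDeg_erase hp S
    have h2 := hB.prop S hS
    by_cases hc : p.1 ∈ S ∧ p.2 ∉ S
    · rw [if_pos hc] at h1
      exact ⟨S, hS, hc.1, hc.2, by omega⟩
    · rw [if_neg hc] at h1
      omega
  obtain ⟨S, hS, hxS, hyS, hSt⟩ := key _ hxy
  obtain ⟨T, hT, hyT, hxT, hTt⟩ := key _ hyx
  have h1 := outDeg_inter_add_union_lt hxy hxS hxT hyS hyT
  have h2 := load_inter_add_union s S T
  have h3 := hB.prop (S ∩ T) (by simp [hS])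
  have h4 := hB.prop (S ∪ T) (by simp [hS, hT])
  omega

/-- Under the cut condition a token at `v` can be moved along some arc, deleting that arc. -/
theorem exists_move {ι : Type*} [Fintype ι] [DecidableEq ι] (s : ι → V) (h : V)
    (A : Finset (V × V)) (hA : ∀ S : Finset V, h ∉ S → load s S ≤ outDeg A S)
    (i : ι) (hi : s i ≠ h) :
    ∃ u, (s i, u) ∈ A ∧ ∀ S : Finset V, h ∉ S →
      load (Function.update s i u) S ≤ outDeg (A.erase (s i, u)) S := by
  -- A maximal tight set avoiding `h` and `s i`; the empty set is tight. Adding `s i` raises the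
  -- load, so some arc from `s i` must leave the enlarged set.
  obtain ⟨T, -, hT⟩ := exists_maximal_ge_of_wellFoundedGT
    (fun S : Finset V => h ∉ S ∧ s i ∉ S ∧ outDeg A S ≤ load s S) ∅ (by simp [outDeg])
  obtain ⟨hhT, hiT, hTt⟩ := hT.prop
  have hload : load s T + 1 ≤ load s (insert (s i) T) := by
    have h2 := add_sum_erase univ (fun j => if s j ∈ insert (s i) T then 1 else 0) (mem_univ i)
    have h3 := add_sum_erase univ (fun j => if s j ∈ T then 1 else 0) (mem_univ i)
    have h4 : ∑ j ∈ univ.erase i, (if s j ∈ T then 1 else 0)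
        ≤ ∑ j ∈ univ.erase i, (if s j ∈ insert (s i) T then 1 else 0) :=
      sum_le_sum fun j _ => by
        by_cases hj : s j ∈ T <;> simp [hj]
    simp only [mem_insert_self, if_true, if_neg hiT] at h2 h3
    unfold load
    omega
  have hex : ∃ u, (s i, u) ∈ A ∧ u ∉ insert (s i) T := by
    by_contra hcon
    push Not at hcon
    have h1 := hA (insert (s i) T) (by simp [hhT, hi.symm])
    have h2 : outDeg A (insert (s i) T) ≤ outDeg A T := by
      rw [outDeg_eq_card, outDeg_eq_card]
      refine card_le_card fun p hp => ?_
      simp only [mem_filter, mem_insert, not_or] at hp ⊢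
      obtain ⟨hpA, hp1 | hp1, hp2⟩ := hp
      · have := hcon p.2 (by rw [← hp1]; exact hpA)
        simp only [mem_insert] at this
        tauto
      · exact ⟨hpA, hp1, hp2.2⟩
    omega
  obtain ⟨u, huA, hu⟩ := hex
  refine ⟨u, huA, fun S hS => ?_⟩
  have h1 := outDeg_erase huA S
  have h2 := load_update s i u S
  have h3 := hA S hS
  by_cases hv : s i ∈ S <;> by_cases huS : u ∈ S <;> simp only [hv, huS, not_true, not_false_iff,
    and_true, and_false, if_true, if_false] at h1 h2
  · omega
  · omega
  -- Only a set that gains the token can fail. Were it tight, its union with `T` would be tight too,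
  -- against maximality, since `u ∉ T`.
  · have h4 : load s S < outDeg A S := by
      by_contra hlt
      have h5 := outDeg_inter_add_union_le A S T
      have h6 := load_inter_add_union s S T
      have h7 := hA (S ∩ T) (by simp [hS])
      have h8 : S ∪ T ≤ T := hT.le_of_ge ⟨by simp [hS, hhT], by simp [hv, hiT], by omega⟩
        subset_union_right
      exact hu (mem_insert_of_mem (h8 (mem_union_left _ huS)))
    omega
  · omega

/-- Edge-disjoint routing to a common vertex `h` in an antisymmetric arc set. -/
theorem exists_walks_of_antisymm (G : SimpleGraph V) {ι : Type*} [Fintype ι] [DecidableEq ι]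
    (h : V) (A : Finset (V × V)) (hG : ∀ p ∈ A, G.Adj p.1 p.2)
    (hanti : ∀ x y, (x, y) ∈ A → (y, x) ∉ A) (s : ι → V)
    (hA : ∀ S : Finset V, h ∉ S → load s S ≤ outDeg A S) :
    ∃ P : ∀ i, G.Walk (s i) h, (∀ i, ∀ e ∈ (P i).edges, ∃ p ∈ A, e = s(p.1, p.2)) ∧
      ∀ i j, i ≠ j → List.Disjoint (P i).edges (P j).edges := by
  induction hn : #A generalizing A s with
  | zero =>
    have hs : ∀ i, s i = h := by
      by_contra hcon
      push Not at hcon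
      obtain ⟨i, hi⟩ := hcon
      obtain ⟨u, hu, -⟩ := exists_move s h A hA i hi
      rw [card_eq_zero.1 hn] at hu
      simp at hu
    exact ⟨fun i => SimpleGraph.Walk.nil.copy (hs i).symm rfl, by simp, by simp⟩
  | succ n ih =>
    by_cases hs : ∀ i, s i = h
    · exact ⟨fun i => SimpleGraph.Walk.nil.copy (hs i).symm rfl, by simp, by simp⟩
    push Not at hs
    obtain ⟨i, hi⟩ := hs
    obtain ⟨u, hu, hmove⟩ := exists_move s h A hA i hi
    obtain ⟨P, hP, hPd⟩ := ih (A.erase (s i, u)) (fun p hp => hG p (mem_of_mem_erase hp))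
      (fun x y hxy hyx => hanti x y (mem_of_mem_erase hxy) (mem_of_mem_erase hyx))
      (Function.update s i u) hmove (by rw [card_erase_of_mem hu, hn]; rfl)
    -- The remaining arcs omit `(s i, u)`, and antisymmetry excludes its reverse, so the whole edge
    -- is unused.
    have hnew : ∀ j, s(s i, u) ∉ (P j).edges := by
      intro j hj
      obtain ⟨⟨x, y⟩, hp, he⟩ := hP j _ hj
      rcases Sym2.eq_iff.1 he with ⟨h1, h2⟩ | ⟨h1, h2⟩
      · simp [h1, h2] at hp
      · have hyx := mem_of_mem_erase hp
        simp only at h1 h2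
        rw [← h1, ← h2] at hyx
        exact hanti _ _ hu hyx
    let Q : ∀ j, G.Walk (s j) h := fun j =>
      if hj : j = i then
        (SimpleGraph.Walk.cons (hG _ hu) ((P i).copy (by simp) rfl)).copy (by rw [hj]) rfl
      else (P j).copy (by rw [Function.update_of_ne hj]) rfl
    have hQi : (Q i).edges = s(s i, u) :: (P i).edges := by simp [Q]
    have hQj : ∀ j, j ≠ i → (Q j).edges = (P j).edges := fun j hj => by simp [Q, hj]
    refine ⟨Q, fun j e he => ?_, fun j k hjk => ?_⟩
    · by_cases hj : j = i
      · subst hj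
        rw [hQi, List.mem_cons] at he
        rcases he with rfl | he
        · exact ⟨_, hu, rfl⟩
        · obtain ⟨p, hp, rfl⟩ := hP _ _ he
          exact ⟨p, mem_of_mem_erase hp, rfl⟩
      · rw [hQj j hj] at he
        obtain ⟨p, hp, rfl⟩ := hP _ _ he
        exact ⟨p, mem_of_mem_erase hp, rfl⟩
    · by_cases hj : j = i
      · subst hj
        rw [hQi, hQj k hjk.symm, List.disjoint_cons_left]
        exact ⟨hnew k, hPd _ _ hjk⟩
      · by_cases hk : k = i
        · subst hk
          rw [hQi, hQj j hjk, List.disjoint_cons_right]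
          exact ⟨hnew j, hPd _ _ hjk⟩
        · rw [hQj j hj, hQj k hk]
          exact hPd _ _ hjk

/-- If every vertex set avoiding `h` has at least as many boundary edges as tokens, then the tokens
can be routed to `h` along pairwise edge-disjoint walks. -/
theorem exists_edge_disjoint_walks (G : SimpleGraph V) {ι : Type*} [Fintype ι] [DecidableEq ι]
    (h : V) (s : ι → V) (hA : ∀ S : Finset V, h ∉ S → load s S ≤ outDeg (arcs G) S) :
    ∃ P : ∀ i, G.Walk (s i) h, ∀ i j, i ≠ j → List.Disjoint (P i).edges (P j).edges := by
  obtain ⟨B, hBA, hB, hanti⟩ := exists_antisymm_subset s h (arcs G) hA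
  obtain ⟨P, -, hP⟩ := exists_walks_of_antisymm G h B (fun p hp => mem_arcs.1 (hBA hp)) hanti s hB
  exact ⟨P, hP⟩

/-- Vertices that are pairwise `(t - 1) ^ 2`-edge-connected are the branch vertices of an immersion
of a complete graph. -/
theorem containsImmersion_of_edgeConnected (G : SimpleGraph V) {t : ℕ} (ht : 1 ≤ t)
    (φ : Fin t ↪ V)
    (hφ : ∀ a b, a ≠ b → ∀ S : Finset V, φ a ∈ S → φ b ∉ S → (t - 1) ^ 2 ≤ outDeg (arcs G) S) :
    ContainsImmersion (SimpleGraph.completeGraph (Fin t)) G := by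
  let z : Fin t := ⟨0, ht⟩
  obtain ⟨P, hP⟩ := exists_edge_disjoint_walks G (ι := {p : Fin t × Fin t // p.1 ≠ p.2}) (φ z)
    (fun p => φ p.1.1) (by
      intro S hS
      by_cases hne : ∃ a, φ a ∈ S
      · obtain ⟨a, ha⟩ := hne
        have haz : a ≠ z := by rintro rfl; exact hS ha
        refine le_trans ?_ (hφ a z haz S ha hS)
        have hcard : load (fun p : {p : Fin t × Fin t // p.1 ≠ p.2} => φ p.1.1) S
            = #{p : {p : Fin t × Fin t // p.1 ≠ p.2} | φ p.1.1 ∈ S} := by simp [load]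
        rw [hcard]
        -- `S` misses the target `φ z`, so it holds at most `t - 1` branch vertices with `t - 1`
        -- tokens each.
        have hle : #{p : {p : Fin t × Fin t // p.1 ≠ p.2} | φ p.1.1 ∈ S}
            ≤ #((univ.erase z).sigma fun a : Fin t => univ.erase a) := by
          refine card_le_card_of_injOn (fun p => ⟨p.1.1, p.1.2⟩) ?_ ?_
          · rintro ⟨⟨a, b⟩, hab⟩ hp
            simp only [coe_filter, mem_univ, true_and, Set.mem_ofPred_eq] at hp
            simp only [coe_sigma, Set.mem_sigma_iff, coe_erase, coe_univ, Set.mem_sdiff,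
              Set.mem_univ, Set.mem_singleton_iff, true_and]
            exact ⟨by rintro rfl; exact hS hp, fun h => hab h.symm⟩
          · rintro ⟨⟨a, b⟩, hab⟩ - ⟨⟨c, d⟩, hcd⟩ - h
            simpa using h
        refine hle.trans ?_
        simp [card_sigma, card_erase_of_mem, sq]
      · push Not at hne
        simp [load, hne])
  have hdisj : ∀ a b c d (hab : a ≠ b) (hcd : c ≠ d), (a, b) ≠ (c, d) →
      List.Disjoint (P ⟨(a, b), hab⟩).edges (P ⟨(c, d), hcd⟩).edges := fun a b c d hab hcd hne =>
    hP _ _ fun h => hne (congrArg Subtype.val h)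
  let Q : ∀ a b : Fin t, a ≠ b → G.Walk (φ a) (φ b) := fun a b hab =>
    ((P ⟨(a, b), hab⟩).append (P ⟨(b, a), hab.symm⟩).reverse).bypass
  have hQ : ∀ a b hab e, e ∈ (Q a b hab).edges →
      e ∈ (P ⟨(a, b), hab⟩).edges ∨ e ∈ (P ⟨(b, a), hab.symm⟩).edges := by
    intro a b hab e he
    have := SimpleGraph.Walk.edges_bypass_subset_edges _ he
    simpa using this
  -- Shortcutting to a path need not commute with reversal, so one orientation defines the other.
  let R : ∀ a b : Fin t, a ≠ b → G.Walk (φ a) (φ b) := fun a b hab =>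
    if a < b then Q a b hab else (Q b a hab.symm).reverse
  have hR : ∀ a b hab e, e ∈ (R a b hab).edges →
      e ∈ (P ⟨(a, b), hab⟩).edges ∨ e ∈ (P ⟨(b, a), hab.symm⟩).edges := by
    intro a b hab e he
    by_cases hlt : a < b
    · simp only [R, if_pos hlt] at he
      exact hQ a b hab e he
    · simp only [R, if_neg hlt, SimpleGraph.Walk.edges_reverse, List.mem_reverse] at he
      exact (hQ b a hab.symm e he).symm
  refine ⟨φ, fun a b hab => R a b hab.ne, fun a b hab => ?_, fun a b hab => ?_, ?_⟩
  · by_cases hlt : a < b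
    · simp only [R, if_pos hlt]
      exact SimpleGraph.Walk.bypass_isPath _
    · simp only [R, if_neg hlt]
      exact (SimpleGraph.Walk.bypass_isPath _).reverse
  · rcases lt_or_gt_of_ne hab.ne with hlt | hlt
    · simp only [R, if_pos hlt, if_neg hlt.not_gt]
    · simp only [R, if_pos hlt, if_neg hlt.not_gt, SimpleGraph.Walk.reverse_reverse]
  · intro a b hab c d hcd hne e he he'
    have h1 := hR a b hab.ne e he
    have h2 := hR c d hcd.ne e he'
    have hne' : ¬ (a = c ∧ b = d) ∧ ¬ (a = d ∧ b = c) := by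
      rw [Ne, Sym2.eq_iff, not_or] at hne
      exact hne
    rcases h1 with h1 | h1 <;> rcases h2 with h2 | h2 <;>
      refine hdisj _ _ _ _ _ _ ?_ h1 h2 <;> rw [Ne, Prod.mk.injEq] <;> tauto

end Cuts

/-! ### Uncrossing small cuts into a laminar family -/

section Laminar

variable {V : Type*} [Fintype V]

/-- A tie-breaking weight, distinct for distinct vertex sets. -/
noncomputable def tieWeight (S : Finset V) : ℕ :=
  ∑ x ∈ S, 2 ^ (Fintype.equivFin V x : ℕ)

theorem tieWeight_eq_sum_map (S : Finset V) : tieWeight S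
    = ∑ i ∈ S.map ((Fintype.equivFin V).toEmbedding.trans Fin.valEmbedding), 2 ^ i := by
  simp [tieWeight]

theorem tieWeight_injective : Function.Injective (tieWeight : Finset V → ℕ) := by
  intro S T h
  rw [tieWeight_eq_sum_map, tieWeight_eq_sum_map] at h
  exact map_injective _ (geomSum_injective le_rfl h)

theorem tieWeight_lt (S : Finset V) : tieWeight S < 2 ^ Fintype.card V := by
  rw [tieWeight_eq_sum_map]
  refine Nat.geomSum_lt le_rfl fun k hk => ?_
  simp only [mem_map] at hk
  obtain ⟨x, -, rfl⟩ := hk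
  exact (Fintype.equivFin V x).2

variable [DecidableEq V]

theorem outDeg_univ (A : Finset (V × V)) : outDeg A univ = 0 := by simp [outDeg]

theorem outDeg_arcs_compl (G : SimpleGraph V) (S : Finset V) :
    outDeg (arcs G) Sᶜ = outDeg (arcs G) S := by
  rw [outDeg_eq_card, outDeg_eq_card]
  refine card_bij (fun p _ => p.swap) ?_ ?_ ?_
  · rintro ⟨x, y⟩ h
    simp only [mem_filter, mem_arcs, mem_compl, not_not, Prod.swap_prod_mk] at h ⊢
    exact ⟨h.1.symm, h.2.2, h.2.1⟩
  · intro p _ q _ h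
    exact Prod.swap_injective h
  · rintro ⟨x, y⟩ h
    simp only [mem_filter, mem_arcs] at h
    exact ⟨(y, x), by simp [h.1.symm, h.2.1, h.2.2], rfl⟩

theorem outDeg_arcs_sdiff_add_sdiff_le (G : SimpleGraph V) (S T : Finset V) :
    outDeg (arcs G) (S \ T) + outDeg (arcs G) (T \ S)
      ≤ outDeg (arcs G) S + outDeg (arcs G) T := by
  have h := outDeg_inter_add_union_le (arcs G) S Tᶜ
  have h1 : S ∪ Tᶜ = (T \ S)ᶜ := by
    ext x; simp only [mem_union, mem_compl, mem_sdiff]; tauto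
  rwa [h1, outDeg_arcs_compl, outDeg_arcs_compl, ← sdiff_eq_inter_compl] at h

/-- The size of the boundary of `S`, perturbed so that ties are broken. -/
noncomputable def cutWeight (G : SimpleGraph V) (S : Finset V) : ℕ :=
  2 ^ Fintype.card V * outDeg (arcs G) S + tieWeight S

theorem cutWeight_injective (G : SimpleGraph V) : Function.Injective (cutWeight G) := by
  intro S T h
  apply tieWeight_injective
  have := congrArg (· % 2 ^ Fintype.card V) h
  simpa [cutWeight, Nat.mod_eq_of_lt (tieWeight_lt _)] using this

theorem outDeg_le_of_cutWeight_le {G : SimpleGraph V} {S T : Finset V}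
    (h : cutWeight G S ≤ cutWeight G T) : outDeg (arcs G) S ≤ outDeg (arcs G) T := by
  have h1 := tieWeight_lt T
  unfold cutWeight at h
  have h2 : 2 ^ Fintype.card V * outDeg (arcs G) S
      < 2 ^ Fintype.card V * (outDeg (arcs G) T + 1) := by
    rw [mul_add, mul_one]; omega
  exact Nat.lt_succ_iff.1 (lt_of_mul_lt_mul_left h2 (Nat.zero_le _))

theorem cutWeight_inter_add_union_le (G : SimpleGraph V) (S T : Finset V) :
    cutWeight G (S ∩ T) + cutWeight G (S ∪ T) ≤ cutWeight G S + cutWeight G T := by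
  have h1 := Nat.mul_le_mul_left (2 ^ Fintype.card V) (outDeg_inter_add_union_le (arcs G) S T)
  have h2 : tieWeight (S ∪ T) + tieWeight (S ∩ T) = tieWeight S + tieWeight T :=
    sum_union_inter
  simp only [mul_add] at h1
  unfold cutWeight
  omega

/-- Posimodularity survives the tie-break because tie weights are monotone. -/
theorem cutWeight_sdiff_add_sdiff_le (G : SimpleGraph V) (S T : Finset V) :
    cutWeight G (S \ T) + cutWeight G (T \ S) ≤ cutWeight G S + cutWeight G T := by
  have h1 := Nat.mul_le_mul_left (2 ^ Fintype.card V) (outDeg_arcs_sdiff_add_sdiff_le G S T)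
  have h2 : tieWeight (S \ T) ≤ tieWeight S := sum_le_sum_of_subset sdiff_subset
  have h3 : tieWeight (T \ S) ≤ tieWeight T := sum_le_sum_of_subset sdiff_subset
  simp only [mul_add] at h1
  unfold cutWeight
  omega

/-- `S` is, for some pair of vertices, the lightest among the sets that avoid `r` and separate the
pair. -/
def IsLightestCut (G : SimpleGraph V) (r : V) (S : Finset V) : Prop :=
  r ∉ S ∧ ∃ u ∈ S, ∃ v ∉ S, ∀ T : Finset V, r ∉ T → T ≠ S → ¬ (u ∈ T ↔ v ∈ T) →
    cutWeight G S < cutWeight G T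

/-- For crossing `A` and `B`, every corner set `A ∩ B`, `A ∪ B`, `A \ B`, `B \ A` separating a
defining pair is strictly heavier than the cut for that pair. Each placement of the two pairs
contradicts submodularity, posimodularity or their sum. -/
theorem IsLightestCut.laminar {G : SimpleGraph V} {r : V} {A B : Finset V}
    (hA : IsLightestCut G r A) (hB : IsLightestCut G r B) : A ⊆ B ∨ B ⊆ A ∨ Disjoint A B := by
  by_contra hcon
  push Not at hcon
  obtain ⟨hAB, hBA, hdis⟩ := hcon
  rw [not_subset] at hAB hBA
  rw [not_disjoint_iff] at hdis
  obtain ⟨x, hxA, hxB⟩ := hAB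
  obtain ⟨y, hyB, hyA⟩ := hBA
  obtain ⟨z, hzA, hzB⟩ := hdis
  obtain ⟨hrA, a, ha, a', ha', hA⟩ := hA
  obtain ⟨hrB, b, hb, b', hb', hB⟩ := hB
  have i1 : A ∩ B ≠ A := fun h => by rw [← h] at hxA; simp [hxB] at hxA
  have i2 : A ∩ B ≠ B := fun h => by rw [← h] at hyB; simp [hyA] at hyB
  have u1 : A ∪ B ≠ A := fun h => by rw [← h] at hyA; simp [hyB] at hyA
  have u2 : A ∪ B ≠ B := fun h => by rw [← h] at hxB; simp [hxA] at hxB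
  have d1 : A \ B ≠ A := fun h => by rw [← h] at hzA; simp [hzB] at hzA
  have d2 : A \ B ≠ B := fun h => by rw [← h] at hyB; simp [hyA] at hyB
  have e1 : B \ A ≠ A := fun h => by rw [← h] at hxA; simp [hxB] at hxA
  have e2 : B \ A ≠ B := fun h => by rw [← h] at hzB; simp [hzA] at hzB
  have s1 := cutWeight_inter_add_union_le G A B
  have s2 := cutWeight_sdiff_add_sdiff_le G A B
  have hA1 := hA (A ∩ B) (by simp [hrA]) i1
  have hA2 := hA (A ∪ B) (by simp [hrA, hrB]) u1
  have hA3 := hA (A \ B) (by simp [hrA]) d1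
  have hA4 := hA (B \ A) (by simp [hrB]) e1
  have hB1 := hB (A ∩ B) (by simp [hrA]) i2
  have hB2 := hB (A ∪ B) (by simp [hrA, hrB]) u2
  have hB3 := hB (A \ B) (by simp [hrA]) d2
  have hB4 := hB (B \ A) (by simp [hrB]) e2
  simp only [mem_inter, mem_union, mem_sdiff, ha, ha', hb, hb'] at hA1 hA2 hA3 hA4 hB1 hB2 hB3 hB4
  by_cases k1 : a ∈ B <;> by_cases k2 : a' ∈ B <;> by_cases k3 : b ∈ A <;> by_cases k4 : b' ∈ A <;>
    simp only [k1, k2, k3, k4, and_true, and_false, or_true, or_false, not_true, not_false_iff,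
      iff_true, iff_false, forall_true_left,
      IsEmpty.forall_iff] at hA1 hA2 hA3 hA4 hB1 hB2 hB3 hB4 <;>
    omega

/-- Two vertices separated by a small cut are separated by a small lightest cut. -/
theorem exists_isLightestCut (G : SimpleGraph V) (r : V) {u v : V} {S : Finset V} (hu : u ∈ S)
    (hv : v ∉ S) : ∃ T, IsLightestCut G r T ∧ outDeg (arcs G) T ≤ outDeg (arcs G) S ∧
      ¬ (u ∈ T ↔ v ∈ T) := by
  obtain ⟨S', hrS', hsep, hS'⟩ : ∃ S' : Finset V, r ∉ S' ∧ ¬ (u ∈ S' ↔ v ∈ S') ∧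
      outDeg (arcs G) S' = outDeg (arcs G) S := by
    by_cases hr : r ∈ S
    · exact ⟨Sᶜ, by simp [hr], by simp [hu, hv], outDeg_arcs_compl G S⟩
    · exact ⟨S, hr, by simp [hu, hv], rfl⟩
  obtain ⟨T, hT, hmin⟩ := exists_min_image
    (univ.filter fun T : Finset V => r ∉ T ∧ ¬ (u ∈ T ↔ v ∈ T)) (cutWeight G)
    ⟨S', by simp only [mem_filter, mem_univ, true_and]; exact ⟨hrS', hsep⟩⟩
  simp only [mem_filter, mem_univ, true_and] at hT hmin
  have hlt : ∀ T' : Finset V, r ∉ T' → T' ≠ T → ¬ (u ∈ T' ↔ v ∈ T') →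
      cutWeight G T < cutWeight G T' := fun T' h1 h2 h3 =>
    lt_of_le_of_ne (hmin T' ⟨h1, h3⟩) fun h => h2 (cutWeight_injective G h).symm
  refine ⟨T, ⟨hT.1, ?_⟩, hS' ▸ outDeg_le_of_cutWeight_le (hmin S' ⟨hrS', hsep⟩), hT.2⟩
  by_cases huT : u ∈ T
  · exact ⟨u, huT, v, fun h => hT.2 (by simp [huT, h]), hlt⟩
  · refine ⟨v, by by_contra h; exact hT.2 (by simp [huT, h]), u, huT, fun T' h1 h2 h3 =>
      hlt T' h1 h2 fun h => h3 h.symm⟩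

end Laminar

/-! ### Two-colouring along a laminar family -/

section Colouring

/-- A 2-colouring of a rooted forest given by its parent function. -/
theorem exists_alternating_colouring {α : Type*} (p : α → α) (f : α → ℕ) (N : ℕ)
    (hN : ∀ y, f y < N) (hp : ∀ y, p y ≠ y → f (p y) < f y) :
    ∃ c : α → Fin 2, ∀ y, p y ≠ y → c (p y) ≠ c y := by
  suffices h : ∀ n, ∃ c : α → Fin 2, ∀ y, f y < n → p y ≠ y → c (p y) ≠ c y by
    obtain ⟨c, hc⟩ := h N
    exact ⟨c, fun y => hc y (hN y)⟩
  intro n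
  induction n with
  | zero => exact ⟨fun _ => 0, by simp⟩
  | succ n ih =>
    obtain ⟨c, hc⟩ := ih
    refine ⟨fun y => if f y < n then c y else c (p y) + 1, fun y hy hpy => ?_⟩
    have h1 := hp y hpy
    simp only [if_pos (show f (p y) < n by omega)]
    split_ifs with h2
    · exact hc y h2 hpy
    · generalize c (p y) = a
      revert a
      decide

variable {V : Type*} [Fintype V]

theorem exists_min_of_laminar {F : Finset (Finset V)}
    (hlam : ∀ A ∈ F, ∀ B ∈ F, A ⊆ B ∨ B ⊆ A ∨ Disjoint A B) (huniv : univ ∈ F) (v : V)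
    (Q : Set V) (hv : v ∈ Q) : ∃ M ∈ F, Q ⊆ M ∧ ∀ Z ∈ F, Q ⊆ Z → M ⊆ Z := by
  classical
  obtain ⟨M, hM, hmin⟩ := exists_min_image (F.filter fun Z : Finset V => Q ⊆ (Z : Set V)) card
    ⟨univ, by simp [huniv]⟩
  simp only [mem_filter] at hM hmin
  refine ⟨M, hM.1, hM.2, fun Z hZ hQZ => ?_⟩
  rcases hlam M hM.1 Z hZ with h | h | h
  · exact h
  · exact (eq_of_subset_of_card_le h (hmin Z ⟨hZ, hQZ⟩)).symm.subset
  · exact absurd (hQZ hv) (disjoint_left.1 h (hM.2 hv))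

variable [DecidableEq V]

/-- A graph with a laminar family of small edge cuts, such that few vertices are pairwise
unseparated by the family, is 2-colourable with bounded defect. -/
theorem colourable_of_laminar (G : SimpleGraph V) (F : Finset (Finset V)) (k n : ℕ)
    (hlam : ∀ A ∈ F, ∀ B ∈ F, A ⊆ B ∨ B ⊆ A ∨ Disjoint A B) (huniv : univ ∈ F)
    (hcut : ∀ A ∈ F, outDeg (arcs G) A ≤ n)
    (hbag : ∀ v, #{w | ∀ A ∈ F, v ∈ A ↔ w ∈ A} ≤ k) :
    ColourableWithDefect G 2 (k - 1 + n * k) := by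
  have hσ : ∀ v : V, ∃ M ∈ F, v ∈ M ∧ ∀ Z ∈ F, v ∈ Z → M ⊆ Z := fun v => by
    simpa using exists_min_of_laminar hlam huniv v {v} rfl
  choose σ hσF hσv hσmin using hσ
  have hbag' : ∀ v, #{w | σ w = σ v} ≤ k := by
    refine fun v => (card_le_card fun w hw => ?_).trans (hbag v)
    simp only [mem_filter, mem_univ, true_and] at hw ⊢
    exact fun A hA => ⟨fun h => hσmin v A hA h (hw ▸ hσv w), fun h => hσmin w A hA h (hw ▸ hσv v)⟩
  -- The parent map `μ`; sets that are empty or outside `F` become roots.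
  have hμ : ∀ Y : Finset V, ∃ M, Y ⊆ M ∧ (Y ∈ F → Y.Nonempty → M ∈ F ∧
      (∀ z z', σ z = Y → G.Adj z z' → z' ∈ M) ∧
      ∀ Z ∈ F, Y ⊆ Z → (∀ z z', σ z = Y → G.Adj z z' → z' ∈ Z) → M ⊆ Z) := by
    intro Y
    by_cases hY : Y ∈ F ∧ Y.Nonempty
    · obtain ⟨y, hy⟩ := hY.2
      obtain ⟨M, hMF, hM, hmin⟩ := exists_min_of_laminar hlam huniv y
        (Y ∪ {z' | ∃ z, σ z = Y ∧ G.Adj z z'}) (Or.inl hy)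
      rw [Set.union_subset_iff] at hM
      refine ⟨M, by exact_mod_cast hM.1, fun _ _ => ⟨hMF, fun z z' h h' => hM.2 ⟨z, h, h'⟩,
        fun Z hZ h1 h2 => hmin Z hZ (Set.union_subset (by exact_mod_cast h1) ?_)⟩⟩
      rintro z' ⟨z, hz, hzz'⟩
      exact h2 z z' hz hzz'
    · exact ⟨Y, subset_rfl, fun h1 h2 => absurd ⟨h1, h2⟩ hY⟩
  choose μ hμs hμ using hμ
  obtain ⟨c, hc⟩ := exists_alternating_colouring μ (fun Y => #Yᶜ) (Fintype.card V + 1)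
    (fun Y => Nat.lt_succ_of_le (card_le_univ _)) (fun Y hY => by
      refine card_lt_card (compl_ssubset_compl.2 ?_)
      exact (hμs Y).ssubset_of_ne hY.symm)
  refine ⟨fun v => c (σ v), fun v => ?_⟩
  let bd : Finset (V × V) := {p ∈ arcs G | p.1 ∈ σ v ∧ p.2 ∉ σ v}
  have hbd : #bd ≤ n := outDeg_eq_card (arcs G) (σ v) ▸ hcut _ (hσF v)
  -- The vertices charged to a boundary edge: the outer end if the inner end is `v`, otherwise the
  -- bag of the inner end.
  let blob : V × V → Finset V := fun p =>
    if p.1 = v then {p.2} else univ.filter fun w => σ w = σ p.1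
  have hk : 1 ≤ k := (card_pos.2 ⟨v, by simp⟩).trans_le (hbag' v)
  have hblob : ∀ p ∈ bd, #(blob p) ≤ k := by
    intro p _
    by_cases hp : p.1 = v
    · simpa [blob, hp] using hk
    · simpa [blob, hp] using hbag' p.1
  let big : Finset V := (univ.filter fun w => σ w = σ v).erase v ∪ bd.biUnion blob
  have hbig : #big ≤ k - 1 + n * k := by
    refine (card_union_le _ _).trans (Nat.add_le_add ?_ ?_)
    · rw [card_erase_of_mem (by simp)]
      exact Nat.sub_le_sub_right (hbag' v) 1
    · exact (card_biUnion_le_card_mul _ _ _ hblob).trans (Nat.mul_le_mul_right k hbd)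
  have hsub : {w : V | G.Adj v w ∧ c (σ w) = c (σ v)} ⊆ (big : Set V) := by
    rintro w ⟨hvw, hcw⟩
    rw [mem_coe, mem_union]
    by_cases hwv : σ w = σ v
    · exact Or.inl (by simp [hwv, hvw.ne'])
    right
    rw [mem_biUnion]
    by_cases hw : w ∈ σ v
    · have hYX : σ w ⊆ σ v := hσmin w _ (hσF v) hw
      obtain ⟨hMF, hM, hMmin⟩ := hμ (σ w) (hσF w) ⟨w, hσv w⟩
      have hXM : σ v ⊆ μ (σ w) := hσmin v _ hMF (hM w v rfl hvw.symm)
      have hne : μ (σ w) ≠ σ v := by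
        intro h
        refine hc (σ w) ?_ ?_
        · rw [h]; exact fun h' => hwv h'.symm
        · rw [h, hcw]
      -- Equal colours rule out `σ v` as the parent of `σ w`, so an edge from the bag of `w` leaves
      -- `σ v`.
      have : ¬ ∀ z z', σ z = σ w → G.Adj z z' → z' ∈ σ v := fun h =>
        hne ((hMmin _ (hσF v) hYX h).antisymm hXM)
      push Not at this
      obtain ⟨z, z', hz, hzz', hz'⟩ := this
      refine ⟨(z, z'), ?_, ?_⟩
      · simp only [bd, mem_filter, mem_arcs]
        exact ⟨hzz', hYX (hz ▸ hσv z), hz'⟩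
      · have hzv : z ≠ v := by rintro rfl; exact hwv hz.symm
        simp [blob, hzv, hz]
    · refine ⟨(v, w), ?_, by simp [blob]⟩
      simp only [bd, mem_filter, mem_arcs]
      exact ⟨hvw, hσv v, hw⟩
  calc _ ≤ (big : Set V).encard := Set.encard_le_encard hsub
    _ = (#big : ℕ∞) := Set.encard_coe_eq_coe_finsetCard big
    _ ≤ _ := by exact_mod_cast hbig

end Colouring

/-! ### The upper bound -/

theorem ColourableWithDefect.mono {V : Type*} {G : SimpleGraph V} {k d d' : ℕ}
    (h : ColourableWithDefect G k d) (hd : d ≤ d') : ColourableWithDefect G k d' := by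
  obtain ⟨c, hc⟩ := h
  exact ⟨c, fun v => (hc v).trans (by exact_mod_cast hd)⟩

theorem colourable_of_immersionFree {V : Type*} [Finite V] (G : SimpleGraph V) {t : ℕ} (ht : 1 ≤ t)
    (hG : ¬ ContainsImmersion (SimpleGraph.completeGraph (Fin t)) G) :
    ColourableWithDefect G 2 ((t - 1) ^ 3) := by
  classical
  have := Fintype.ofFinite V
  rcases isEmpty_or_nonempty V with hV | ⟨⟨r⟩⟩
  · exact ⟨fun _ => 0, fun v => hV.elim v⟩
  let F : Finset (Finset V) :=
    insert univ (univ.filter fun S => IsLightestCut G r S ∧ outDeg (arcs G) S < (t - 1) ^ 2)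
  have hbag : ∀ v, #{w | ∀ A ∈ F, v ∈ A ↔ w ∈ A} ≤ t - 1 := by
    intro v
    by_contra hlt
    obtain ⟨B, hB, hBt⟩ := exists_subset_card_eq
      (show t ≤ #{w | ∀ A ∈ F, v ∈ A ↔ w ∈ A} by omega)
    refine hG (containsImmersion_of_edgeConnected G ht
      ((B.equivFinOfCardEq hBt).symm.toEmbedding.trans (Function.Embedding.subtype _)) ?_)
    intro a b _ S ha hb
    by_contra hS
    obtain ⟨T, hT, hTS, hsep⟩ := exists_isLightestCut G r ha hb
    have hTF : T ∈ F := by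
      simp only [F, mem_insert, mem_filter, mem_univ, true_and]
      exact Or.inr ⟨hT, by omega⟩
    have hmem : ∀ x : B, v ∈ T ↔ (x : V) ∈ T := fun x => by
      have := hB x.2
      simp only [mem_filter, mem_univ, true_and] at this
      exact this T hTF
    exact hsep ((hmem _).symm.trans (hmem _))
  have hcol := colourable_of_laminar G F (t - 1) ((t - 1) ^ 2 - 1) (by
      intro A hA B hB
      simp only [F, mem_insert, mem_filter, mem_univ, true_and] at hA hB
      rcases hA with rfl | hA
      · exact Or.inr (Or.inl (subset_univ _))
      rcases hB with rfl | hB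
      · exact Or.inl (subset_univ _)
      exact hA.1.laminar hB.1) (mem_insert_self _ _) (by
      intro A hA
      simp only [F, mem_insert, mem_filter, mem_univ, true_and] at hA
      rcases hA with rfl | hA
      · rw [outDeg_univ]; exact Nat.zero_le _
      · omega) hbag
  refine hcol.mono ?_
  -- With `m = t - 1 ≥ 1`, the defect obtained is `m - 1 + (m ^ 2 - 1) * m = m ^ 3 - 1`.
  have hk : 1 ≤ t - 1 := (card_pos.2 ⟨r, by simp⟩).trans_le (hbag r)
  obtain ⟨k, hk'⟩ : ∃ k, t - 1 = k + 1 := ⟨t - 2, by omega⟩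
  have hsq : (k + 1) ^ 2 - 1 = k ^ 2 + 2 * k := by
    have : (k + 1) ^ 2 = k ^ 2 + 2 * k + 1 := by ring
    omega
  rw [hk', hsq, Nat.add_sub_cancel]
  nlinarith

/-! ### Stars and the lower bound -/

/-- The star with `n` leaves. -/
def liftedStar (n : ℕ) : SimpleGraph (ULift.{u} (Option (Fin n))) where
  Adj x y := (x.down = none ∧ y.down ≠ none) ∨ (x.down ≠ none ∧ y.down = none)
  symm := ⟨fun x y h => by tauto⟩
  loopless := ⟨fun x h => by tauto⟩

/-- A leaf has one edge, so it cannot start two edge-disjoint nontrivial paths; every branch vertex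
would have to be the centre. -/
theorem star_immersionFree (n : ℕ) {t : ℕ} (ht : 3 ≤ t) :
    ¬ ContainsImmersion (SimpleGraph.completeGraph (Fin t)) (liftedStar.{u} n) := by
  rintro ⟨φ, P, -, -, hdisj⟩
  have hfirst : ∀ {x y : ULift.{u} (Option (Fin n))} (p : (liftedStar.{u} n).Walk x y), x ≠ y →
      x.down ≠ none → s(x, ⟨none⟩) ∈ p.edges := by
    intro x y p hxy hx
    cases p with
    | nil => exact absurd rfl hxy
    | @cons _ z _ h q =>
      have hz : z = ⟨none⟩ := by
        apply ULift.ext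
        rcases h with h | h
        · exact absurd h.1 hx
        · exact h.2
      subst hz
      simp
  have key : ∀ a b c : Fin t, a ≠ b → a ≠ c → b ≠ c → (φ a).down = none := by
    intro a b c hab hac hbc
    by_contra ha
    refine hdisj a b hab a c hac (by simp [hbc, hac])
      (hfirst _ (φ.injective.ne hab) ha) (hfirst _ (φ.injective.ne hac) ha)
  have h0 := key ⟨0, by omega⟩ ⟨1, by omega⟩ ⟨2, by omega⟩ (by simp) (by simp) (by simp)
  have h1 := key ⟨1, by omega⟩ ⟨0, by omega⟩ ⟨2, by omega⟩ (by simp) (by simp) (by simp)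
  have := φ.injective (ULift.ext _ _ (h0.trans h1.symm))
  simp at this

theorem star_not_colourable {k d : ℕ} (hk : k < 2) :
    ¬ ColourableWithDefect (liftedStar.{u} (d + 1)) k d := by
  rintro ⟨c, hc⟩
  have hsub : Subsingleton (Fin k) := Fin.subsingleton_iff_le_one.2 (by omega)
  have h := hc ⟨none⟩
  have hset : Set.range (fun i : Fin (d + 1) => (⟨some i⟩ : ULift.{u} (Option (Fin (d + 1)))))
      ⊆ {w | (liftedStar.{u} (d + 1)).Adj ⟨none⟩ w ∧ c w = c ⟨none⟩} := by
    rintro _ ⟨i, rfl⟩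
    exact ⟨Or.inl ⟨rfl, by simp⟩, Subsingleton.elim _ _⟩
  have h2 := (Set.encard_le_encard hset).trans h
  rw [← Set.image_univ, Function.Injective.encard_image (fun i j hij => by simpa using hij)] at h2
  simp only [Set.encard_univ, ENat.card_eq_coe_fintype_card, Fintype.card_fin] at h2
  have h3 : d + 1 ≤ d := by exact_mod_cast h2
  omega

theorem mainTheorem5 (t : ℕ) (ht : 1 ≤ t) :
    (∀ (V : Type u) [Finite V] (G : SimpleGraph V),
      immersionFree t V G → ColourableWithDefect G 2 ((t - 1) ^ 3)) ∧
    (3 ≤ t → defectiveChromaticNumber (immersionFree.{u} t) = 2) := by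
  have hcol : ∀ (V : Type u) [Finite V] (G : SimpleGraph V),
      immersionFree t V G → ColourableWithDefect G 2 ((t - 1) ^ 3) :=
    fun V _ G hG => colourable_of_immersionFree G ht hG
  refine ⟨hcol, fun h3 => le_antisymm (sInf_le ⟨2, rfl, _, hcol⟩) (le_sInf ?_)⟩
  rintro _ ⟨k, rfl, d, hd⟩
  by_contra hk
  have hk' : k < 2 := by
    rw [not_le] at hk
    exact_mod_cast hk
  exact star_not_colourable hk' (hd _ (liftedStar.{u} (d + 1)) (star_immersionFree _ h3))
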